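/- Let $\tau\in\mathbb C$ be an imaginary quadratic algebraic integer, i.e. $\tau^2-p\tau+q=0$ with $p,q\in\mathbb Z$ and $4q-p^2>0$, and suppose $|\tau|>1$. Let $w\ge 2$ be an integer. Let $V=\{z\in\mathbb C : |z|\le|z-y| \text{ for all } y\in\mathbb Z[\tau]\}$ be the Voronoi cell of $0$, and let $\widetilde V$ be a restricted Voronoi cell, i.e. any set with $\operatorname{int}V\subseteq\widetilde V\subseteq V$ such that $\mathbb C$ is the disjoint union of the translates $u+\widetilde V$, $u\in\mathbb Z[\tau]$. Let $\mathcal D\subseteq\mathbb Z[\tau]$ be the minimal norm representatives digit set modulo $\tau^w$, i.e. $\mathcal D$ consists of $0$ and exactly one representative of each residue class of $\mathbb Z[\tau]$ modulo $\tau^w$ that is not divisible by $\tau$, and each nonzero digit lies in $\tau^w\widetilde V$. A $w$-NAF is a sequence $\boldsymbol\eta=(\eta_j)_{j\in\mathbb Z}\in\mathcal D^{\mathbb Z}$ in which each block $\eta_{j+w-1}\dots\eta_j$ of length $w$ contains at most one nonzero digit; it is an integer $w$-NAF if only finitely many of its digits are nonzero and $\eta_j=0$ for all $j<0$. If $\eta_j=0$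 for all sufficiently large $j$, put $\operatorname{value}(\boldsymbol\eta)=\sum_{j\in\mathbb Z}\eta_j\tau^j$. The fundamental domain $\mathcal F$ is the set of the values of all $w$-NAFs with $\eta_j=0$ for all $j\ge 0$. Then the following holds for each $K\in\mathbb Z$. Let $I_K$ be the set of all pairs $(k,\boldsymbol\xi)$ with $k\in\{K,K+1,\dots,K+w-1\}$ and $\boldsymbol\xi$ an integer $w$-NAF such that $\xi_0\ne 0$ if $k\neq K+w-1$, and for $(k,\boldsymbol\xi)\in I_K$ put $T_{k,\boldsymbol\xi}=\tau^k\operatorname{value}(\boldsymbol\xi)+\tau^{k-w+1}\mathcal F$. Then $$\mathbb C=\bigcup_{(k,\boldsymbol\xi)\in I_K}T_{k,\boldsymbol\xi},$$ and for any two distinct pairs $(k,\boldsymbol\xi),(k',\boldsymbol\xi')\in I_K$, $$T_{k,\boldsymbol\xi}\cap T_{k',\boldsymbol\xi'}\subseteq\partial T_{k,\boldsymbol\xi}\cap\partial T_{k',\boldsymbol\xi'}.$$ -/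

import Mathlib

noncomputable section

namespace WNAF

/-- `τ` is an imaginary quadratic algebraic integer: a root of `X ^ 2 - p X + q` with integers
`p`, `q` such that `4 q - p ^ 2 > 0`. -/
def IsImaginaryQuadraticInteger (τ : ℂ) : Prop :=
  ∃ p q : ℤ, τ ^ 2 - (p : ℂ) * τ + (q : ℂ) = 0 ∧ 0 < 4 * q - p ^ 2

/-- The lattice `ℤ[τ]`, as a subset of `ℂ`. -/
def lattice (τ : ℂ) : Set ℂ := (Algebra.adjoin ℤ {τ} : Subalgebra ℤ ℂ)

/-- Divisibility of `b` by `a` in the ring `ℤ[τ]`: the quotient lies in `ℤ[τ]`. -/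
def LatticeDvd (τ a b : ℂ) : Prop := ∃ c ∈ lattice τ, b = a * c

/-- The Voronoi cell of `0` for the lattice `ℤ[τ]`. -/
def voronoiCell (τ : ℂ) : Set ℂ := {z | ∀ y ∈ lattice τ, ‖z‖ ≤ ‖z - y‖}

/-- `R` is a restricted Voronoi cell (of `0`): the interior of the Voronoi cell together with a
part of its boundary, chosen such that the translates of `R` by the elements of `ℤ[τ]` cover `ℂ`
without overlaps. -/
structure IsRestrictedVoronoiCell (τ : ℂ) (R : Set ℂ) : Prop where
  interior_subset : interior (voronoiCell τ) ⊆ R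
  subset_cell : R ⊆ voronoiCell τ
  partition : ∀ z : ℂ, ∃! u : ℂ, u ∈ lattice τ ∧ z - u ∈ R

/-- A reduced residue digit set modulo `τ ^ w`: a subset of `ℤ[τ]` that consists of `0` and of
exactly one representative of each residue class modulo `τ ^ w` not divisible by `τ`. -/
structure IsReducedResidueDigitSet (τ : ℂ) (w : ℕ) (D : Set ℂ) : Prop where
  subset_lattice : D ⊆ lattice τ
  zero_mem : (0 : ℂ) ∈ D
  not_dvd : ∀ η ∈ D, η ≠ 0 → ¬ LatticeDvd τ τ η
  existsUnique_rep : ∀ z ∈ lattice τ, ¬ LatticeDvd τ τ z →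
    ∃! η : ℂ, η ∈ D ∧ LatticeDvd τ (τ ^ w) (z - η)

/-- A minimal norm representatives digit set modulo `τ ^ w`, with respect to the restricted
Voronoi cell `R`: all nonzero digits lie in `τ ^ w R`. -/
structure IsMinNormDigitSet (τ : ℂ) (w : ℕ) (R D : Set ℂ) : Prop
    extends IsReducedResidueDigitSet τ w D where
  minimal : ∀ η ∈ D, η ≠ 0 → ∃ v ∈ R, η = τ ^ w * v

/-- Width-`w` non-adjacent forms over `D`: two-sided sequences of digits in which each block of
length `w` contains at most one nonzero digit. -/
def IsWNAF (w : ℕ) (D : Set ℂ) (η : ℤ → ℂ) : Prop :=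
  (∀ j, η j ∈ D) ∧ ∀ j : ℤ, {i : ℤ | i ∈ Set.Ico j (j + w) ∧ η i ≠ 0}.Subsingleton

/-- Integer `w`-NAFs: finite left-length, and right-length `0`. -/
def integerWNAFs (w : ℕ) (D : Set ℂ) : Set (ℤ → ℂ) :=
  {η | IsWNAF w D η ∧ (∃ l : ℤ, ∀ j, l ≤ j → η j = 0) ∧ ∀ j < 0, η j = 0}

/-- `w`-NAFs of left-length `0` (and arbitrary, possibly infinite, right-length). -/
def fractionalWNAFs (w : ℕ) (D : Set ℂ) : Set (ℤ → ℂ) :=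
  {η | IsWNAF w D η ∧ ∀ j, 0 ≤ j → η j = 0}

/-- The value `∑ j, η j τ ^ j` of a digit sequence. The series converges absolutely if `1 < ‖τ‖`,
the digits are bounded, and only finitely many digits at nonnegative indices are nonzero. -/
def value (τ : ℂ) (η : ℤ → ℂ) : ℂ := ∑' j : ℤ, η j * τ ^ j

/-- The fundamental domain. -/
def fundamentalDomain (τ : ℂ) (w : ℕ) (D : Set ℂ) : Set ℂ := value τ '' fractionalWNAFs w D

/-- The set `τ ^ k value(ξ) + τ ^ (k - w + 1) F`. -/
def tile (τ : ℂ) (w : ℕ) (D : Set ℂ) (k : ℤ) (ξ : ℤ → ℂ) : Set ℂ :=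
  (fun y : ℂ => τ ^ k * value τ ξ + τ ^ (k - (w : ℤ) + 1) * y) '' fundamentalDomain τ w D

/-- The pairs `(k, ξ)` with `k ∈ {K, …, K + w - 1}` and `ξ` an integer `w`-NAF such that
`k ≠ K + w - 1` implies `ξ 0 ≠ 0`. -/
def tilingIndex (w : ℕ) (D : Set ℂ) (K : ℤ) : Set (ℤ × (ℤ → ℂ)) :=
  {i | i.1 ∈ Set.Icc K (K + (w : ℤ) - 1) ∧ i.2 ∈ integerWNAFs w D ∧
    (i.1 ≠ K + (w : ℤ) - 1 → i.2 0 ≠ 0)}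

end WNAF

end

/-!
The lattice `ℤ[τ]` enters through two facts: multiplication by `τ` scales areas by the norm
`q = |τ| ^ 2`, and there are at most `q ^ w - q ^ (w - 1)` nonzero digits, since they represent
different residue classes modulo `τ ^ w` that are not divisible by `τ`
(`exists_finset_nonzero_digits`).

*Covering.* Every element of `ℤ[τ]` has an integer `w`-NAF (`lattice_subset_image_value`). If `τ`
does not divide `z`, then `z = d + τ ^ w u` for a digit `d`, and since `d` has minimal norm in its
residue class, `q ^ w |u| ^ 2 + |z + d| ^ 2 ≤ 4 |z| ^ 2` (`exists_digit_step`). So passing from `z`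
to `u` decreases the norm, except possibly if `q ^ w = 4` and `d = -z`; this case is settled by
looking at two consecutive steps. Hence all points of the dense set `⋃ n, τ ^ (-n) ℤ[τ]` lie in
tiles (`exists_mem_tile`). The fundamental domain is compact, and, by uniqueness of integer
`w`-NAFs (`injOn_value`), the tiles form a locally finite family (`locallyFinite_tile`), so their
union is closed and is the whole plane (`iUnion_tile_eq_univ`).

*Overlaps.* The plane being a countable union of scaled copies of the fundamental domain `F`, the
area of `F` is positive. Sorting fractional `w`-NAFs by their digit at index `-1` shows that `F` is
covered by `τ⁻¹ F` and the sets `d τ⁻¹ + τ ^ (-w) F` for the nonzero digits `d`. The areas of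
these pieces add up to at most `(1 / q + (q ^ w - q ^ (w - 1)) / q ^ w) |F| = |F|`, so the pieces
overlap in null sets only (`volume_piece_inter_piece`). Two distinct tiles branch into distinct
pieces at the highest index where their digits differ, so they overlap in a null set as well
(`volume_tile_inter_tile`). On the other hand, every neighbourhood of a point of a tile contains a
small copy of `F` inside the tile (`volume_fundamentalDomain_inter_ne_zero`), hence no tile meets
the interior of another one.
-/

namespace WNAF

/-! ### The lattice `ℤ[τ]` -/

lemma zero_mem_lattice {τ : ℂ} : (0 : ℂ) ∈ lattice τ := (Algebra.adjoin ℤ {τ}).zero_mem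

lemma intCast_mem_lattice {τ : ℂ} (n : ℤ) : (n : ℂ) ∈ lattice τ :=
  (Algebra.adjoin ℤ {τ}).intCast_mem n

lemma self_mem_lattice {τ : ℂ} : τ ∈ lattice τ := Algebra.self_mem_adjoin_singleton ℤ τ

lemma add_mem_lattice {τ x y : ℂ} (hx : x ∈ lattice τ) (hy : y ∈ lattice τ) :
    x + y ∈ lattice τ := (Algebra.adjoin ℤ {τ}).add_mem hx hy

lemma sub_mem_lattice {τ x y : ℂ} (hx : x ∈ lattice τ) (hy : y ∈ lattice τ) :
    x - y ∈ lattice τ := (Algebra.adjoin ℤ {τ}).sub_mem hx hy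

lemma neg_mem_lattice {τ x : ℂ} (hx : x ∈ lattice τ) : -x ∈ lattice τ :=
  (Algebra.adjoin ℤ {τ}).neg_mem hx

lemma mul_mem_lattice {τ x y : ℂ} (hx : x ∈ lattice τ) (hy : y ∈ lattice τ) :
    x * y ∈ lattice τ := (Algebra.adjoin ℤ {τ}).mul_mem hx hy

lemma pow_mem_lattice {τ x : ℂ} (hx : x ∈ lattice τ) (n : ℕ) : x ^ n ∈ lattice τ :=
  (Algebra.adjoin ℤ {τ}).pow_mem hx n

lemma sum_mem_lattice {τ : ℂ} {ι : Type*} {s : Finset ι} {f : ι → ℂ}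
    (h : ∀ i ∈ s, f i ∈ lattice τ) : ∑ i ∈ s, f i ∈ lattice τ :=
  (Algebra.adjoin ℤ {τ}).sum_mem h

lemma LatticeDvd.sub {τ a x y : ℂ} (hx : LatticeDvd τ a x) (hy : LatticeDvd τ a y) :
    LatticeDvd τ a (x - y) := by
  obtain ⟨c, hc, rfl⟩ := hx
  obtain ⟨d, hd, rfl⟩ := hy
  exact ⟨c - d, sub_mem_lattice hc hd, by ring⟩

lemma LatticeDvd.of_pow {τ x : ℂ} {w : ℕ} (hw : 1 ≤ w) (h : LatticeDvd τ (τ ^ w) x) :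
    LatticeDvd τ τ x := by
  obtain ⟨c, hc, rfl⟩ := h
  refine ⟨τ ^ (w - 1) * c, mul_mem_lattice (pow_mem_lattice self_mem_lattice _) hc, ?_⟩
  rw [← mul_assoc, mul_pow_sub_one (by omega)]

lemma mem_lattice_iff {τ : ℂ} {p q : ℤ} (h : τ ^ 2 - (p : ℂ) * τ + (q : ℂ) = 0) {z : ℂ} :
    z ∈ lattice τ ↔ ∃ a b : ℤ, z = a + b * τ := by
  constructor
  · intro hz
    induction hz using Algebra.adjoin_induction with
    | mem x hx => exact ⟨0, 1, by simpa using hx⟩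
    | algebraMap r => exact ⟨r, 0, by simp⟩
    | add x y _ _ hx hy =>
      obtain ⟨a, b, rfl⟩ := hx
      obtain ⟨c, d, rfl⟩ := hy
      exact ⟨a + c, b + d, by push_cast; ring⟩
    | mul x y _ _ hx hy =>
      obtain ⟨a, b, rfl⟩ := hx
      obtain ⟨c, d, rfl⟩ := hy
      refine ⟨a * c - b * d * q, a * d + b * c + b * d * p, ?_⟩
      push_cast
      linear_combination (b * d : ℂ) * h
  · rintro ⟨a, b, rfl⟩
    exact add_mem_lattice (intCast_mem_lattice a)
      (mul_mem_lattice (intCast_mem_lattice b) self_mem_lattice)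

lemma re_im_of_root {τ : ℂ} {p q : ℤ} (h : τ ^ 2 - (p : ℂ) * τ + (q : ℂ) = 0)
    (hpq : 0 < 4 * q - p ^ 2) : 2 * τ.re = p ∧ Complex.normSq τ = q ∧ τ.im ≠ 0 := by
  have hre := congrArg Complex.re h
  have him := congrArg Complex.im h
  simp [pow_two] at hre him
  have hpq' : (0 : ℝ) < 4 * q - p ^ 2 := by exact_mod_cast hpq
  have h0 : τ.im ≠ 0 := by
    intro h0
    rw [h0] at hre
    nlinarith [sq_nonneg (2 * τ.re - p)]
  have h1 : 2 * τ.re = p := by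
    have : τ.im * (2 * τ.re - p) = 0 := by linear_combination him
    rcases mul_eq_zero.1 this with h | h
    · exact absurd h h0
    · linarith
  refine ⟨h1, ?_, h0⟩
  rw [Complex.normSq_apply]
  linear_combination τ.re * h1 - hre

lemma exists_normSq_eq_natCast {τ : ℂ} {p q : ℤ} (h : τ ^ 2 - (p : ℂ) * τ + (q : ℂ) = 0)
    (hpq : 0 < 4 * q - p ^ 2) {z : ℂ} (hz : z ∈ lattice τ) :
    ∃ n : ℕ, Complex.normSq z = n := by
  obtain ⟨a, b, rfl⟩ := (mem_lattice_iff h).1 hz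
  obtain ⟨h1, h2, -⟩ := re_im_of_root h hpq
  have key : Complex.normSq (a + b * τ) = ((a ^ 2 + a * b * p + b ^ 2 * q : ℤ) : ℝ) := by
    rw [Complex.normSq_apply] at h2 ⊢
    push_cast
    simp
    linear_combination (b : ℝ) ^ 2 * h2 + a * b * h1
  have hnn : 0 ≤ a ^ 2 + a * b * p + b ^ 2 * q := by
    have := Complex.normSq_nonneg (a + b * τ)
    rw [key] at this
    exact_mod_cast this
  obtain ⟨n, hn⟩ := Int.eq_ofNat_of_zero_le hnn
  exact ⟨n, by rw [key, hn]; simp⟩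

lemma finite_lattice_inter_closedBall {τ : ℂ} (hτ : IsImaginaryQuadraticInteger τ) (r : ℝ) :
    {z | z ∈ lattice τ ∧ ‖z‖ ≤ r}.Finite := by
  obtain ⟨p, q, h, hpq⟩ := hτ
  obtain ⟨h1, h2, h0⟩ := re_im_of_root h hpq
  set y := |τ.im| with hy
  have hy0 : 0 < y := abs_pos.2 h0
  set N := ⌈r / y⌉ with hN
  set M := ⌈r + N * ‖τ‖⌉ with hM
  refine ((Set.finite_Icc (-M) M).image2 (fun a b : ℤ => (a + b * τ : ℂ))
    (Set.finite_Icc (-N) N)).subset ?_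
  rintro z ⟨hz, hr⟩
  obtain ⟨a, b, rfl⟩ := (mem_lattice_iff h).1 hz
  have hb : |(b : ℝ)| ≤ N := by
    refine le_trans ?_ (Int.le_ceil _)
    rw [le_div_iff₀ hy0]
    have := Complex.abs_im_le_norm (a + b * τ)
    simp [abs_mul] at this
    exact this.trans hr
  have ha : |(a : ℝ)| ≤ M := by
    refine le_trans ?_ (Int.le_ceil _)
    have : ‖(a : ℂ)‖ ≤ ‖(a + b * τ : ℂ)‖ + ‖(b * τ : ℂ)‖ := by
      simpa using norm_sub_le (a + b * τ : ℂ) (b * τ)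
    rw [norm_mul, Complex.norm_intCast, Complex.norm_intCast] at this
    nlinarith [norm_nonneg τ]
  have ha' : |a| ≤ M := by exact_mod_cast ha
  have hb' : |b| ≤ N := by exact_mod_cast hb
  exact ⟨a, abs_le.1 ha', b, abs_le.1 hb', rfl⟩

lemma countable_lattice {τ : ℂ} (hτ : IsImaginaryQuadraticInteger τ) : (lattice τ).Countable := by
  obtain ⟨p, q, h, -⟩ := hτ
  refine (Set.countable_range fun x : ℤ × ℤ => (x.1 + x.2 * τ : ℂ)).mono fun z hz => ?_
  obtain ⟨a, b, rfl⟩ := (mem_lattice_iff h).1 hz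
  exact ⟨(a, b), rfl⟩

lemma exists_mem_lattice_norm_sub_le {τ : ℂ} (hτ : IsImaginaryQuadraticInteger τ) (z : ℂ) :
    ∃ y ∈ lattice τ, ‖z - y‖ ≤ 1 + ‖τ‖ := by
  obtain ⟨p, q, h, hpq⟩ := hτ
  obtain ⟨-, -, h0⟩ := re_im_of_root h hpq
  -- real coordinates of `z` with respect to the basis `1`, `τ`
  set t := z.im / τ.im
  set s := z.re - t * τ.re
  have hz : z = s + t * τ := by
    apply Complex.ext <;> simp [s, t, h0]
  refine ⟨⌊s⌋ + ⌊t⌋ * τ, (mem_lattice_iff h).2 ⟨_, _, rfl⟩, ?_⟩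
  have : z - (⌊s⌋ + ⌊t⌋ * τ) = ((Int.fract s : ℝ) : ℂ) + ((Int.fract t : ℝ) : ℂ) * τ := by
    rw [hz, Int.fract, Int.fract]
    push_cast
    ring
  rw [this]
  refine (norm_add_le _ _).trans ?_
  rw [norm_mul, Complex.norm_real, Complex.norm_real, Real.norm_of_nonneg (Int.fract_nonneg _),
    Real.norm_of_nonneg (Int.fract_nonneg _)]
  nlinarith [Int.fract_lt_one s, Int.fract_lt_one t, norm_nonneg τ]

/-- The integers `0, …, q - 1` represent all residue classes of `ℤ[τ]` modulo `τ`. -/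
lemma exists_eq_natCast_add_mul {τ : ℂ} {p q : ℤ} (h : τ ^ 2 - (p : ℂ) * τ + (q : ℂ) = 0)
    (hq : 0 < q) {z : ℂ} (hz : z ∈ lattice τ) :
    ∃ a : ℕ, a < q.toNat ∧ ∃ c ∈ lattice τ, z = a + τ * c := by
  obtain ⟨a, b, rfl⟩ := (mem_lattice_iff h).1 hz
  have h1 := Int.emod_nonneg a hq.ne'
  have h2 := Int.emod_lt_of_pos a hq
  have h3 := Int.emod_add_mul_ediv a q
  generalize a % q = r at h1 h2 h3
  generalize a / q = m at h3
  lift r to ℕ using h1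
  -- `q = τ (p - τ)` is divisible by `τ`
  refine ⟨r, by omega, m * (p - τ) + b, add_mem_lattice (mul_mem_lattice (intCast_mem_lattice m)
    (sub_mem_lattice (intCast_mem_lattice p) self_mem_lattice)) (intCast_mem_lattice b), ?_⟩
  rw [← h3]
  push_cast
  linear_combination (m : ℂ) * h

/-- There are at most `q ^ n` residue classes of `ℤ[τ]` modulo `τ ^ n`. -/
lemma exists_residue_system {τ : ℂ} {p q : ℤ} (h : τ ^ 2 - (p : ℂ) * τ + (q : ℂ) = 0)
    (hq : 0 < q) (n : ℕ) :
    ∃ S : Finset ℂ, S.card ≤ q.toNat ^ n ∧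
      ∀ z ∈ lattice τ, ∃ s ∈ S, LatticeDvd τ (τ ^ n) (z - s) := by
  classical
  induction n with
  | zero => exact ⟨{0}, by simp, fun z hz => ⟨0, by simp, z, hz, by simp⟩⟩
  | succ n ih =>
    obtain ⟨S, hS, hS'⟩ := ih
    refine ⟨Finset.image₂ (fun (a : ℕ) s => (a : ℂ) + τ * s) (Finset.range q.toNat) S, ?_, ?_⟩
    · refine (Finset.card_image₂_le _ _ _).trans ?_
      rw [Finset.card_range, pow_succ']
      gcongr
    · intro z hz
      obtain ⟨a, ha, c, hc, rfl⟩ := exists_eq_natCast_add_mul h hq hz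
      obtain ⟨s, hs, d, hd, hcd⟩ := hS' c hc
      refine ⟨_, Finset.mem_image₂_of_mem (Finset.mem_range.2 ha) hs, d, hd, ?_⟩
      linear_combination τ * hcd

/-- A reduced residue digit set has at most `(q - 1) q ^ (w - 1)` nonzero digits. -/
lemma exists_finset_nonzero_digits {τ : ℂ} {p q : ℤ} (h : τ ^ 2 - (p : ℂ) * τ + (q : ℂ) = 0)
    (hq : 0 < q) {w : ℕ} {D : Set ℂ} (hD : IsReducedResidueDigitSet τ (w + 1) D) :
    ∃ E : Finset ℂ, (∀ d, d ∈ E ↔ d ∈ D ∧ d ≠ 0) ∧ E.card ≤ (q.toNat - 1) * q.toNat ^ w := by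
  classical
  obtain ⟨S, hS, hS'⟩ := exists_residue_system h hq w
  set T : Finset ℂ := Finset.image₂ (fun (a : ℕ) s => ((a + 1 : ℕ) : ℂ) + τ * s)
    (Finset.range (q.toNat - 1)) S
  have hT : T.card ≤ (q.toNat - 1) * q.toNat ^ w := by
    refine (Finset.card_image₂_le _ _ _).trans ?_
    rw [Finset.card_range]
    gcongr
  have key : ∀ d : {d // d ∈ D ∧ d ≠ 0}, ∃ t : T, LatticeDvd τ (τ ^ (w + 1)) (d - t) := by
    rintro ⟨d, hd, hd0⟩
    obtain ⟨a, ha, c, hc, hdc⟩ := exists_eq_natCast_add_mul h hq (hD.subset_lattice hd)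
    obtain ⟨s, hs, e, he, hce⟩ := hS' c hc
    obtain _ | a := a
    · exact absurd ⟨c, hc, by simpa using hdc⟩ (hD.not_dvd d hd hd0)
    · refine ⟨⟨_, Finset.mem_image₂_of_mem (Finset.mem_range.2 (by omega : a < _)) hs⟩, e, he, ?_⟩
      simp only [hdc]
      linear_combination τ * hce
  choose f hf using key
  have hinj : Function.Injective f := by
    rintro ⟨d, hd, hd0⟩ ⟨e, he, he0⟩ hde
    have h1 := hf ⟨d, hd, hd0⟩
    have h2 := hf ⟨e, he, he0⟩
    rw [← hde] at h2
    obtain ⟨x, -, hx⟩ := hD.existsUnique_rep d (hD.subset_lattice hd) (hD.not_dvd d hd hd0)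
    have h3 := hx d ⟨hd, 0, zero_mem_lattice, by simp⟩
    have h4 := hx e ⟨he, by simpa using h1.sub h2⟩
    exact Subtype.ext (h3.trans h4.symm)
  have : Finite {d // d ∈ D ∧ d ≠ 0} := Finite.of_injective f hinj
  have : Fintype {d // d ∈ D ∧ d ≠ 0} := Fintype.ofFinite _
  refine ⟨Finset.univ.map (Function.Embedding.subtype fun d => d ∈ D ∧ d ≠ 0), fun d => ?_, ?_⟩
  · simp only [Finset.mem_map, Finset.mem_univ, true_and, Function.Embedding.subtype_apply]
    exact ⟨by rintro ⟨a, rfl⟩; exact a.2, fun hd => ⟨⟨d, hd⟩, rfl⟩⟩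
  rw [Finset.card_map]
  exact (Fintype.card_le_of_injective f hinj).trans (by rwa [Fintype.card_coe])

lemma IsReducedResidueDigitSet.finite {τ : ℂ} (hτ : IsImaginaryQuadraticInteger τ) {w : ℕ}
    (hw : 1 ≤ w) {D : Set ℂ} (hD : IsReducedResidueDigitSet τ w D) : D.Finite := by
  obtain ⟨p, q, h, hpq⟩ := hτ
  obtain ⟨w, rfl⟩ := Nat.exists_eq_add_of_le' hw
  obtain ⟨E, hE, -⟩ := exists_finset_nonzero_digits h (by nlinarith) hD
  refine (insert 0 E).finite_toSet.subset fun d hd => ?_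
  by_cases h0 : d = 0 <;> simp [h0, hE, hd]

/-! ### Digit sequences and their values -/

lemma isWNAF_iff {w : ℕ} {D : Set ℂ} {η : ℤ → ℂ} :
    IsWNAF w D η ↔ (∀ j, η j ∈ D) ∧ ∀ i j : ℤ, i < j → j < i + w → η i = 0 ∨ η j = 0 := by
  refine and_congr_right fun _ => ⟨fun h i j hij hj => ?_, fun h j a ha b hb => ?_⟩
  · by_contra! hne
    exact hij.ne (h i ⟨⟨le_rfl, by omega⟩, hne.1⟩ ⟨⟨hij.le, hj⟩, hne.2⟩)
  · obtain ⟨⟨ha1, ha2⟩, ha0⟩ := ha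
    obtain ⟨⟨hb1, hb2⟩, hb0⟩ := hb
    rcases lt_trichotomy a b with hab | hab | hab
    · exact absurd (h a b hab (by omega)) (by tauto)
    · exact hab
    · exact absurd (h b a hab (by omega)) (by tauto)

lemma IsWNAF.shift {w : ℕ} {D : Set ℂ} {η : ℤ → ℂ} (h : IsWNAF w D η) (m : ℤ) :
    IsWNAF w D (fun j => η (j + m)) := by
  rw [isWNAF_iff] at h ⊢
  exact ⟨fun j => h.1 _, fun i j hij hj => h.2 _ _ (by omega) (by omega)⟩

lemma IsWNAF.of_eq_or_eq_zero {w : ℕ} {D : Set ℂ} (h0 : (0 : ℂ) ∈ D) {η ζ : ℤ → ℂ}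
    (h : IsWNAF w D η) (hζ : ∀ j, ζ j = η j ∨ ζ j = 0) : IsWNAF w D ζ := by
  rw [isWNAF_iff] at h ⊢
  refine ⟨fun j => ?_, fun i j hij hj => ?_⟩
  · rcases hζ j with hj | hj <;> rw [hj]
    exacts [h.1 j, h0]
  · rcases hζ i with h1 | h1
    · rcases hζ j with h2 | h2
      · rw [h1, h2]
        exact h.2 i j hij hj
      · exact Or.inr h2
    · exact Or.inl h1

/-- The digits of `η` at indices `≥ m`. -/
def upper (m : ℤ) (η : ℤ → ℂ) : ℤ → ℂ := fun j => if m ≤ j then η j else 0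

/-- The digits of `η` at indices `< m`, shifted such that they end up at the negative indices. -/
def lower (m : ℤ) (η : ℤ → ℂ) : ℤ → ℂ := fun j => if j < 0 then η (j + m) else 0

/-- The digits of `η` together with those of `f`, where `f` is shifted such that its digit at
index `-1` ends up at index `m - w`. -/
def concat (w : ℕ) (m : ℤ) (η f : ℤ → ℂ) : ℤ → ℂ := fun j => η j + f (j + (w - 1 - m))

lemma upper_of_le {m j : ℤ} {η : ℤ → ℂ} (h : m ≤ j) : upper m η j = η j := if_pos h

lemma upper_of_lt {m j : ℤ} {η : ℤ → ℂ} (h : j < m) : upper m η j = 0 := if_neg h.not_ge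

lemma IsWNAF.upper {w : ℕ} {D : Set ℂ} (h0 : (0 : ℂ) ∈ D) {η : ℤ → ℂ} (h : IsWNAF w D η)
    (m : ℤ) : IsWNAF w D (upper m η) :=
  h.of_eq_or_eq_zero h0 fun j => by unfold WNAF.upper; split_ifs <;> simp

lemma IsWNAF.lower_mem {w : ℕ} {D : Set ℂ} (h0 : (0 : ℂ) ∈ D) {η : ℤ → ℂ} (h : IsWNAF w D η)
    (m : ℤ) : lower m η ∈ fractionalWNAFs w D :=
  ⟨(h.shift m).of_eq_or_eq_zero h0 fun j => by unfold lower; split_ifs <;> simp,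
    fun _ hj => if_neg hj.not_gt⟩

/-- A fractional `w`-NAF may be appended to a `w`-NAF after a gap of `w - 1` zeros. -/
lemma IsWNAF.concat {w : ℕ} (hw : 1 ≤ w) {D : Set ℂ} {η f : ℤ → ℂ} {m : ℤ} (h : IsWNAF w D η)
    (hm : ∀ j < m, η j = 0) (hf : f ∈ fractionalWNAFs w D) : IsWNAF w D (concat w m η f) := by
  have h1 := isWNAF_iff.1 h
  have h2 := isWNAF_iff.1 (hf.1.shift (w - 1 - m))
  have h3 : ∀ j, m - w < j → f (j + (w - 1 - m)) = 0 := fun j hj => hf.2 _ (by omega)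
  refine isWNAF_iff.2 ⟨fun j => ?_, fun i j hij hj => ?_⟩ <;> simp only [WNAF.concat]
  · rcases lt_or_ge j m with hjm | hjm
    · simpa [hm j hjm] using h2.1 j
    · simpa [h3 j (by omega)] using h1.1 j
  · rcases lt_or_ge j m with hjm | hjm
    · simpa [hm j hjm, hm i (hij.trans hjm)] using h2.2 i j hij hj
    · simpa [h3 j (by omega), h3 i (by omega)] using h1.2 i j hij hj

lemma exists_norm_le_of_finite {D : Set ℂ} (hD : D.Finite) : ∃ B, 0 ≤ B ∧ ∀ d ∈ D, ‖d‖ ≤ B := by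
  obtain ⟨B, hB⟩ := hD.isBounded.exists_norm_le
  exact ⟨max B 0, le_max_right _ _, fun d hd => (hB d hd).trans (le_max_left _ _)⟩

/-- The summable majorant of the terms of `value τ η` for digits bounded by `B` and located at
indices `< l`. -/
lemma summable_majorant {τ : ℂ} (hτ1 : 1 < ‖τ‖) (B : ℝ) (l : ℤ) :
    Summable fun j : ℤ => if j < l then B * ‖τ‖ ^ j else 0 := by
  refine Summable.of_nat_of_neg ?_ ?_
  · refine summable_of_hasFiniteSupport ((Set.finite_lt_nat l.toNat).subset fun n hn => ?_)
    by_contra h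
    exact hn (if_neg fun h' => h (by simpa using h'))
  · have h1 : Summable fun n : ℕ => |B| * (‖τ‖⁻¹) ^ n :=
      (summable_geometric_of_lt_one (by positivity) (inv_lt_one_of_one_lt₀ hτ1)).mul_left _
    refine Summable.of_norm_bounded h1 fun n => ?_
    split_ifs
    · simp [zpow_neg]
    · simp only [norm_zero]
      positivity

lemma norm_term_le {τ : ℂ} {B : ℝ} {η : ℤ → ℂ} (hη : ∀ j, ‖η j‖ ≤ B) {l : ℤ}
    (hl : ∀ j, l ≤ j → η j = 0) (j : ℤ) :
    ‖η j * τ ^ j‖ ≤ if j < l then B * ‖τ‖ ^ j else 0 := by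
  split_ifs with h
  · rw [norm_mul, norm_zpow]
    have := hη j
    gcongr
  · simp [hl j (not_lt.1 h)]

lemma summable_value {τ : ℂ} (hτ1 : 1 < ‖τ‖) {D : Set ℂ} (hD : D.Finite) {η : ℤ → ℂ}
    (hη : ∀ j, η j ∈ D) {l : ℤ} (hl : ∀ j, l ≤ j → η j = 0) :
    Summable fun j : ℤ => η j * τ ^ j := by
  obtain ⟨B, -, hB⟩ := exists_norm_le_of_finite hD
  exact Summable.of_norm_bounded (summable_majorant hτ1 B l)
    (norm_term_le (fun j => hB _ (hη j)) hl)

lemma value_shift {τ : ℂ} (hτ0 : τ ≠ 0) (η : ℤ → ℂ) (m : ℤ) :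
    value τ (fun j => η (j + m)) = τ ^ (-m) * value τ η := by
  unfold value
  rw [← tsum_mul_left, ← (Equiv.addRight m).tsum_eq (fun j => τ ^ (-m) * (η j * τ ^ j))]
  refine tsum_congr fun j => ?_
  simp only [Equiv.coe_addRight]
  rw [zpow_add₀ hτ0, zpow_neg]
  field_simp

/-- The value of a `w`-NAF, split at the index `m`. -/
lemma IsWNAF.value_eq {τ : ℂ} (hτ1 : 1 < ‖τ‖) {w : ℕ} {D : Set ℂ} (hD : D.Finite)
    (h0 : (0 : ℂ) ∈ D) {η : ℤ → ℂ} (h : IsWNAF w D η) {l : ℤ} (hl : ∀ j, l ≤ j → η j = 0)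
    (m : ℤ) : value τ η = value τ (WNAF.upper m η) + τ ^ m * value τ (lower m η) := by
  have hτ0 : τ ≠ 0 := norm_pos_iff.1 (one_pos.trans hτ1)
  have h1 : τ ^ m * value τ (lower m η) = value τ (fun j => lower m η (j + -m)) := by
    rw [value_shift hτ0, neg_neg]
  rw [h1]
  unfold value
  rw [← Summable.tsum_add]
  · refine tsum_congr fun j => ?_
    unfold WNAF.upper lower
    by_cases hj : m ≤ j
    · simp [hj]
    · simp [hj, not_le.1 hj]
  · refine summable_value hτ1 hD (h.upper h0 m).1 (l := l) fun j hj => ?_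
    unfold WNAF.upper
    simp [hl j hj]
  · exact summable_value hτ1 hD ((h.lower_mem h0 m).1.shift (-m)).1 (l := m)
      fun j hj => (h.lower_mem h0 m).2 _ (by omega)

lemma value_concat {τ : ℂ} (hτ1 : 1 < ‖τ‖) {w : ℕ} {D : Set ℂ} (hD : D.Finite)
    {η f : ℤ → ℂ} {l : ℤ} (m : ℤ) (h : IsWNAF w D η) (hl : ∀ j, l ≤ j → η j = 0)
    (hf : f ∈ fractionalWNAFs w D) :
    value τ (concat w m η f) = value τ η + τ ^ (m - w + 1) * value τ f := by
  have hτ0 : τ ≠ 0 := norm_pos_iff.1 (one_pos.trans hτ1)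
  have h1 := value_shift hτ0 f (w - 1 - m)
  rw [show -((w : ℤ) - 1 - m) = m - w + 1 by ring] at h1
  rw [← h1]
  unfold value concat
  rw [← Summable.tsum_add (summable_value hτ1 hD h.1 hl)]
  · exact tsum_congr fun j => by ring
  · exact summable_value hτ1 hD (hf.1.shift _).1 (l := m - w + 1) fun j hj => hf.2 _ (by omega)

lemma value_single (τ d : ℂ) (m : ℤ) : value τ (Pi.single m d) = d * τ ^ m := by
  unfold value
  rw [tsum_eq_single m]
  · simp
  · intro j hj
    simp [Pi.single_eq_of_ne hj]

/-- The value of a finite digit sequence without digits at indices `< m` is divisible by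
`τ ^ m`. -/
lemma latticeDvd_value {τ : ℂ} {η : ℤ → ℂ} (hη : ∀ j, η j ∈ lattice τ) (m : ℕ)
    {l : ℤ} (hl : ∀ j, l ≤ j → η j = 0) (hm : ∀ j < (m : ℤ), η j = 0) :
    LatticeDvd τ (τ ^ m) (value τ η) := by
  refine ⟨∑ j ∈ Finset.Ico (m : ℤ) l, η j * τ ^ (j - m).toNat, sum_mem_lattice fun j _ =>
    mul_mem_lattice (hη j) (pow_mem_lattice self_mem_lattice _), ?_⟩
  unfold value
  rw [tsum_eq_sum (s := Finset.Ico (m : ℤ) l), Finset.mul_sum]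
  · refine Finset.sum_congr rfl fun j hj => ?_
    rw [Finset.mem_Ico] at hj
    obtain ⟨n, rfl⟩ := Int.eq_ofNat_of_zero_le (show 0 ≤ j by omega)
    have hn : m ≤ n := by simpa using hj.1
    have : ((n : ℤ) - m).toNat = n - m := by omega
    simp only [this, zpow_natCast]
    rw [mul_left_comm, ← pow_add, Nat.add_sub_of_le hn]
  · intro j hj
    rw [Finset.mem_Ico, not_and_or, not_le, not_lt] at hj
    rcases hj with hj | hj
    · simp [hm j hj]
    · simp [hl j hj]

lemma mapsTo_value_lattice {τ : ℂ} {w : ℕ} {D : Set ℂ} (hD : D ⊆ lattice τ) :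
    Set.MapsTo (value τ) (integerWNAFs w D) (lattice τ) := by
  rintro ξ ⟨h1, ⟨l, hl⟩, h2⟩
  obtain ⟨c, hc, hcv⟩ := latticeDvd_value (τ := τ) (fun j => hD (h1.1 j)) 0 hl (by simpa using h2)
  rw [hcv]
  simpa using hc

/-! ### Existence of integer `w`-NAFs -/

lemma zero_mem_integerWNAFs {w : ℕ} {D : Set ℂ} (h0 : (0 : ℂ) ∈ D) :
    (0 : ℤ → ℂ) ∈ integerWNAFs w D :=
  ⟨isWNAF_iff.2 ⟨fun _ => h0, fun _ _ _ _ => Or.inl rfl⟩, ⟨0, fun _ _ => rfl⟩, fun _ _ => rfl⟩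

lemma zero_mem_image_value {τ : ℂ} {w : ℕ} {D : Set ℂ} (h0 : (0 : ℂ) ∈ D) :
    (0 : ℂ) ∈ value τ '' integerWNAFs w D :=
  ⟨0, zero_mem_integerWNAFs h0, by simp [value]⟩

lemma mul_mem_image_value {τ : ℂ} (hτ0 : τ ≠ 0) {w : ℕ} {D : Set ℂ} {z : ℂ}
    (hz : z ∈ value τ '' integerWNAFs w D) :
    τ * z ∈ value τ '' integerWNAFs w D := by
  obtain ⟨ξ, ⟨h1, ⟨l, hl⟩, h2⟩, rfl⟩ := hz
  refine ⟨fun j => ξ (j + -1), ⟨h1.shift _, ⟨l + 1, fun j hj => hl _ (by omega)⟩,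
    fun j hj => h2 _ (by omega)⟩, ?_⟩
  simp [value_shift hτ0]

lemma digit_add_mem_image_value {τ : ℂ} (hτ1 : 1 < ‖τ‖) {w : ℕ} (hw : 1 ≤ w) {D : Set ℂ}
    (hD : D.Finite) (h0 : (0 : ℂ) ∈ D) {d z : ℂ} (hd : d ∈ D)
    (hz : z ∈ value τ '' integerWNAFs w D) :
    d + τ ^ w * z ∈ value τ '' integerWNAFs w D := by
  have hτ0 : τ ≠ 0 := norm_pos_iff.1 (one_pos.trans hτ1)
  obtain ⟨ξ, ⟨h1, ⟨l, hl⟩, h2⟩, rfl⟩ := hz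
  have hs : Pi.single (-1) d ∈ fractionalWNAFs w D := by
    refine ⟨isWNAF_iff.2 ⟨fun j => ?_, fun i j hij _ => ?_⟩, fun j hj => ?_⟩
    · by_cases hj : j = -1
      · subst hj; simpa using hd
      · simpa [Pi.single_eq_of_ne hj] using h0
    · by_cases hj : i = -1
      · exact Or.inr (Pi.single_eq_of_ne (by omega) _)
      · exact Or.inl (Pi.single_eq_of_ne hj _)
    · exact Pi.single_eq_of_ne (by omega) _
  have h3 : IsWNAF w D (fun j => ξ (j + -w)) := h1.shift _
  have h4 : ∀ j < (w : ℤ), ξ (j + -w) = 0 := fun j hj => h2 _ (by omega)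
  have h5 : ∀ j, l + w ≤ j → ξ (j + -w) = 0 := fun j hj => hl _ (by omega)
  refine ⟨concat w w _ (Pi.single (-1) d), ⟨h3.concat hw h4 hs, ⟨max (l + w) 1, fun j hj => ?_⟩,
    fun j hj => ?_⟩, ?_⟩
  · simp only [concat]
    rw [h5 j (by omega), Pi.single_eq_of_ne (by omega), add_zero]
  · simp only [concat]
    rw [h4 j (by omega), Pi.single_eq_of_ne (by omega), add_zero]
  · rw [value_concat hτ1 hD w h3 h5 hs, value_shift hτ0, value_single, neg_neg]
    simp
    field_simp
    ring

/-- One step of the digit algorithm, with the norm estimate that follows from the minimality of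
the digit by the parallelogram law. -/
lemma exists_digit_step {τ : ℂ} {w : ℕ} {R D : Set ℂ}
    (hR : IsRestrictedVoronoiCell τ R) (hD : IsMinNormDigitSet τ w R D) (hw : 1 ≤ w) {z : ℂ}
    (hz : z ∈ lattice τ) (hdvd : ¬ LatticeDvd τ τ z) :
    ∃ d ∈ D, ∃ u ∈ lattice τ, z = d + τ ^ w * u ∧
      Complex.normSq τ ^ w * Complex.normSq u + Complex.normSq (z + d) ≤
        4 * Complex.normSq z := by
  obtain ⟨d, ⟨hd, u, hu, hdu⟩, -⟩ := hD.existsUnique_rep z hz hdvd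
  have hd0 : d ≠ 0 := by
    rintro rfl
    exact hdvd (LatticeDvd.of_pow hw ⟨u, hu, by simpa using hdu⟩)
  refine ⟨d, hd, u, hu, by rw [← hdu]; ring, ?_⟩
  obtain ⟨v, hv, hdv⟩ := hD.minimal d hd hd0
  have h1 := hR.subset_cell hv (-u) (neg_mem_lattice hu)
  have h2 : ‖d‖ ≤ ‖z‖ := by
    have : z = τ ^ w * (v - -u) := by linear_combination hdu + hdv
    rw [hdv, this, norm_mul, norm_mul]
    gcongr
  have h3 : Complex.normSq d ≤ Complex.normSq z := by
    rw [Complex.normSq_eq_norm_sq, Complex.normSq_eq_norm_sq]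
    gcongr
  rw [← map_pow, ← map_mul, ← hdu]
  have h4 : Complex.normSq (z - d) + Complex.normSq (z + d) =
      2 * Complex.normSq z + 2 * Complex.normSq d := by
    simp only [Complex.normSq_apply, Complex.add_re, Complex.add_im, Complex.sub_re,
      Complex.sub_im]
    ring
  linarith

/-- If the norm of `τ` is `2`, then `τ ^ 2 = -2`, or `τ ^ 4 = -4`, or `τ` divides all `z` that
satisfy `2 z = τ ^ 2 u` for some `u` in `ℤ[τ]`. -/
lemma cases_of_norm_two {τ : ℂ} {p : ℤ} (h : τ ^ 2 - (p : ℂ) * τ + 2 = 0)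
    (hp : p ^ 2 < 8) (hτ0 : τ ≠ 0) :
    τ ^ 2 = -2 ∨ τ ^ 4 = -4 ∨
      ∀ z ∈ lattice τ, ∀ u ∈ lattice τ, τ ^ 2 * u = 2 * z → LatticeDvd τ τ z := by
  have h1 : p ≤ 2 := by nlinarith
  have h2 : -2 ≤ p := by nlinarith
  have hodd : ∀ z ∈ lattice τ, ∀ u ∈ lattice τ, τ ^ 2 * u = 2 * z → p * z = τ * (z + u) := by
    intro z _ u _ hzu
    refine mul_left_cancel₀ hτ0 ?_
    linear_combination -z * h - hzu
  interval_cases p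
  · right; left
    push_cast at h
    linear_combination (τ ^ 2 - 2 * τ + 2) * h
  · right; right
    intro z hz u hu hzu
    have := hodd z hz u hu hzu
    push_cast at this
    exact ⟨-(z + u), neg_mem_lattice (add_mem_lattice hz hu), by linear_combination -this⟩
  · left
    push_cast at h
    linear_combination h
  · right; right
    intro z hz u hu hzu
    have := hodd z hz u hu hzu
    push_cast at this
    exact ⟨z + u, add_mem_lattice hz hu, by linear_combination this⟩
  · right; left
    push_cast at h
    linear_combination (τ ^ 2 + 2 * τ + 2) * h

/-- Every element of `ℤ[τ]` has an integer `w`-NAF. The norm decreases under the digit algorithm,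
except possibly for `q = w = 2`, where it may stay constant for at most two consecutive steps. -/
theorem lattice_subset_image_value {τ : ℂ} (hτ : IsImaginaryQuadraticInteger τ) (hτ1 : 1 < ‖τ‖)
    {w : ℕ} (hw : 2 ≤ w) {R : Set ℂ} (hR : IsRestrictedVoronoiCell τ R)
    {D : Set ℂ} (hD : IsMinNormDigitSet τ w R D) :
    lattice τ ⊆ value τ '' integerWNAFs w D := by
  have hτ0 : τ ≠ 0 := norm_pos_iff.1 (one_pos.trans hτ1)
  have hfin := hD.finite hτ (by omega)
  obtain ⟨p, q, h, hpq⟩ := hτ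
  obtain ⟨-, hq, -⟩ := re_im_of_root h hpq
  have hq1 : 1 < q := by
    have : 1 < Complex.normSq τ := by
      rw [Complex.normSq_eq_norm_sq]; nlinarith
    rw [hq] at this
    exact_mod_cast this
  suffices ∀ n : ℕ, ∀ z ∈ lattice τ, Complex.normSq z = n →
      z ∈ value τ '' integerWNAFs w D by
    intro z hz
    obtain ⟨n, hn⟩ := exists_normSq_eq_natCast h hpq hz
    exact this n z hz hn
  intro n
  induction n using Nat.strong_induction_on with
  | _ n ih =>
  have ih' : ∀ z ∈ lattice τ, Complex.normSq z < n → z ∈ value τ '' integerWNAFs w D := by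
    intro z hz hzn
    obtain ⟨m, hm⟩ := exists_normSq_eq_natCast h hpq hz
    rw [hm] at hzn
    exact ih m (by exact_mod_cast hzn) z hz hm
  have hdiv : ∀ z ∈ lattice τ, Complex.normSq z = n → LatticeDvd τ τ z →
      z ∈ value τ '' integerWNAFs w D := by
    rintro z hz hzn ⟨c, hc, rfl⟩
    rcases eq_or_ne c 0 with rfl | hc0
    · simpa using zero_mem_image_value hD.zero_mem
    · refine mul_mem_image_value hτ0 (ih' c hc ?_)
      rw [map_mul, hq] at hzn
      have h1 : 0 < Complex.normSq c := Complex.normSq_pos.2 hc0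
      have h2 : (1 : ℝ) < q := by exact_mod_cast hq1
      nlinarith
  -- Either `z` has a `w`-NAF, or a step with constant norm is possible.
  have hstep : ∀ z ∈ lattice τ, Complex.normSq z = n → z ∈ value τ '' integerWNAFs w D ∨
      (q = 2 ∧ w = 2 ∧ -z ∈ D ∧ ¬ LatticeDvd τ τ z ∧ ∃ u ∈ lattice τ, Complex.normSq u = n ∧
        τ ^ 2 * u = 2 * z ∧
        (u ∈ value τ '' integerWNAFs w D → z ∈ value τ '' integerWNAFs w D)) := by
    intro z hz hzn
    by_cases hdvd : LatticeDvd τ τ z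
    · exact Or.inl (hdiv z hz hzn hdvd)
    obtain ⟨d, hd, u, hu, hzu, hle⟩ := exists_digit_step hR hD (by omega) hz hdvd
    have hstep : u ∈ value τ '' integerWNAFs w D → z ∈ value τ '' integerWNAFs w D := fun hu' =>
      hzu ▸ digit_add_mem_image_value hτ1 (by omega) hfin hD.zero_mem hd hu'
    have hz0 : 0 < Complex.normSq z := by
      refine Complex.normSq_pos.2 ?_
      rintro rfl
      exact hdvd ⟨0, zero_mem_lattice, by simp⟩
    have hun := Complex.normSq_nonneg u
    have hzd := Complex.normSq_nonneg (z + d)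
    rcases lt_or_ge (Complex.normSq u) n with hlt | hge
    · exact Or.inl (hstep (ih' u hu hlt))
    right
    rw [hq, ← hzn] at *
    have hqw : q ^ w ≤ 4 := by
      have : (q : ℝ) ^ w ≤ 4 := by
        by_contra! hgt
        nlinarith
      exact_mod_cast this
    have hw2 : w = 2 := by
      by_contra hne
      have h1 : (2 : ℤ) ^ 3 ≤ q ^ w :=
        (pow_le_pow_left₀ (by norm_num) (by omega) 3).trans
          (pow_le_pow_right₀ (by omega) (by omega))
      omega
    subst hw2
    have hq2 : q = 2 := by nlinarith
    subst hq2
    push_cast at hle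
    have h2 : Complex.normSq (z + d) = 0 := by nlinarith
    have h3 : z + d = 0 := Complex.normSq_eq_zero.1 h2
    have h4 : d = -z := by linear_combination h3
    refine ⟨rfl, rfl, h4 ▸ hd, hdvd, u, hu, by nlinarith, ?_, hstep⟩
    linear_combination -hzu - h3
  have hdigit : ∀ d ∈ D, d ∈ value τ '' integerWNAFs w D := fun d hd => by
    simpa using digit_add_mem_image_value hτ1 (by omega) hfin hD.zero_mem hd
      (zero_mem_image_value (τ := τ) hD.zero_mem)
  intro z hz hzn
  rcases hstep z hz hzn with hres | ⟨rfl, rfl, hzD, hzdvd, u, hu, hun, hzu, himp⟩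
  · exact hres
  refine himp ?_
  rcases hstep u hu hun with hres | ⟨-, -, -, -, u', hu', -, huu', himp'⟩
  · exact hres
  rcases cases_of_norm_two (by exact_mod_cast h) (by omega) hτ0 with h2 | h4 | hdvd
  · -- here `u = -z` is a digit
    have : u = -z := by linear_combination (-1 / 2 : ℂ) * hzu + u / 2 * h2
    exact this ▸ hdigit _ hzD
  · -- here `u' = -z` is a digit
    have : u' = -z := by
      linear_combination (-1 / 4 : ℂ) * τ ^ 2 * huu' - (1 / 2 : ℂ) * hzu + u' / 4 * h4
    exact himp' (this ▸ hdigit _ hzD)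
  · exact absurd (hdvd z hz u hu hzu) hzdvd

/-! ### Uniqueness of integer `w`-NAFs -/

/-- At the lowest index where two integer `w`-NAFs with the same value differ, neither of them has
a nonzero digit: its residue class modulo `τ ^ w` would determine the digit of the other one. -/
lemma eq_zero_of_value_eq {τ : ℂ} (hτ1 : 1 < ‖τ‖) {w : ℕ} (hw : 1 ≤ w) {D : Set ℂ}
    (hfin : D.Finite) (hD : IsReducedResidueDigitSet τ w D) {ξ ζ : ℤ → ℂ}
    (hξ : ξ ∈ integerWNAFs w D) (hζ : ζ ∈ integerWNAFs w D) (h : value τ ξ = value τ ζ) {n : ℕ}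
    (hlt : ∀ m < n, ξ m = ζ m) (hne : ξ n ≠ ζ n) : ξ n = 0 := by
  have hτ0 : τ ≠ 0 := norm_pos_iff.1 (one_pos.trans hτ1)
  by_contra hξn
  have h0 := hD.zero_mem
  -- the digits of a `w`-NAF from `n` on
  have key : ∀ η ∈ integerWNAFs w D, ∀ k : ℕ, (∀ j : ℤ, n < j → j < n + 1 + k → η j = 0) →
      ∃ c ∈ lattice τ,
        value τ η = τ ^ (n : ℤ) * value τ (lower n η) + τ ^ n * η n + τ ^ (n + 1 + k) * c := by
    rintro η ⟨h1, ⟨l, hl⟩, h2⟩ k hk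
    have hu := h1.upper h0 n
    have hul : ∀ j, l ≤ j → upper n η j = 0 := fun j hj => by
      unfold upper
      simp [hl j hj]
    have e1 := h1.value_eq hτ1 hfin h0 hl n
    have e2 : value τ (upper n η) = η n * τ ^ n + value τ (upper (n + 1) η) := by
      rw [← zpow_natCast, ← value_single]
      unfold value
      rw [← Summable.tsum_add]
      · refine tsum_congr fun j => ?_
        rcases lt_trichotomy j n with hj | hj | hj
        · rw [upper_of_lt hj, upper_of_lt (by omega), Pi.single_eq_of_ne hj.ne]
          simp
        · rw [upper_of_le hj.ge, upper_of_lt (by omega), hj]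
          simp
        · rw [upper_of_le hj.le, upper_of_le (by omega), Pi.single_eq_of_ne hj.ne']
          simp
      · refine summable_of_hasFiniteSupport ((Set.finite_singleton (n : ℤ)).subset fun j hj => ?_)
        by_contra hjn
        exact hj (by simp [Pi.single_eq_of_ne hjn])
      · refine summable_value hτ1 hfin (h1.upper h0 _).1 (l := l) fun j hj => ?_
        unfold upper
        simp [hl j hj]
    obtain ⟨c, hc, hcv⟩ := latticeDvd_value (τ := τ) (η := upper (n + 1) η)
      (fun j => hD.subset_lattice ((h1.upper h0 _).1 j)) (n + 1 + k) (l := l)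
      (fun j hj => by unfold upper; simp [hl j hj]) (fun j hj => by
        rcases lt_or_ge j (n + 1) with hjn | hjn
        · exact upper_of_lt hjn
        · rw [upper_of_le hjn]
          exact hk j (by omega) (by push_cast at hj; omega))
    exact ⟨c, hc, by rw [e1, e2, hcv]; ring⟩
  have hlow : lower n ξ = lower n ζ := by
    funext j
    unfold lower
    split_ifs with hj
    · rcases lt_or_ge (j + n) 0 with hjn | hjn
      · rw [hξ.2.2 _ hjn, hζ.2.2 _ hjn]
      · obtain ⟨m, hm⟩ := Int.eq_ofNat_of_zero_le hjn
        rw [hm]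
        exact hlt m (by omega)
    · rfl
  obtain ⟨w, rfl⟩ := Nat.exists_eq_add_of_le' hw
  have hpow : τ ^ n ≠ 0 := pow_ne_zero _ hτ0
  have hgap : ∀ η ∈ integerWNAFs (w + 1) D, η n ≠ 0 →
      ∀ j : ℤ, n < j → j < n + 1 + w → η j = 0 := fun η hη hn j h1 h2 =>
    ((isWNAF_iff.1 hη.1).2 n j h1 (by push_cast; omega)).resolve_left hn
  have hξD := hξ.1.1 n
  have hndvd := hD.not_dvd _ hξD hξn
  obtain ⟨c, hc, hcv⟩ := key ξ hξ w (hgap ξ hξ hξn)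
  -- `ζ n` is congruent to `ξ n` modulo `τ`, hence nonzero
  have hζn : ζ n ≠ 0 := by
    intro hζn
    obtain ⟨d, hd, hdv⟩ := key ζ hζ 0 (fun j h1 h2 => by push_cast at h2; omega)
    refine hndvd ⟨d - τ ^ w * c, sub_mem_lattice hd
      (mul_mem_lattice (pow_mem_lattice self_mem_lattice _) hc), mul_left_cancel₀ hpow ?_⟩
    rw [h, hdv, hζn, hlow] at hcv
    linear_combination -hcv
  -- therefore `ζ n` is congruent to `ξ n` modulo `τ ^ w`
  obtain ⟨d, hd, hdv⟩ := key ζ hζ w (hgap ζ hζ hζn)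
  obtain ⟨x, -, hx⟩ := hD.existsUnique_rep _ (hD.subset_lattice hξD) hndvd
  refine hne ((hx _ ⟨hξD, 0, zero_mem_lattice, by simp⟩).trans
    (hx _ ⟨hζ.1.1 n, d - c, sub_mem_lattice hd hc, mul_left_cancel₀ hpow ?_⟩).symm)
  rw [h, hdv, hlow] at hcv
  linear_combination -hcv

theorem injOn_value {τ : ℂ} (hτ1 : 1 < ‖τ‖) {w : ℕ} (hw : 1 ≤ w) {D : Set ℂ}
    (hfin : D.Finite) (hD : IsReducedResidueDigitSet τ w D) :
    Set.InjOn (value τ) (integerWNAFs w D) := by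
  classical
  intro ξ hξ ζ hζ h
  by_contra hne
  have hex : ∃ n : ℕ, ξ n ≠ ζ n := by
    by_contra! hall
    refine hne (funext fun j => ?_)
    rcases lt_or_ge j 0 with hj | hj
    · rw [hξ.2.2 j hj, hζ.2.2 j hj]
    · obtain ⟨n, rfl⟩ := Int.eq_ofNat_of_zero_le hj
      exact hall n
  have hmin : ∀ m < Nat.find hex, ξ m = ζ m := fun m hm => not_not.1 (Nat.find_min hex hm)
  refine Nat.find_spec hex ?_
  rw [eq_zero_of_value_eq hτ1 hw hfin hD hξ hζ h hmin (Nat.find_spec hex),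
    eq_zero_of_value_eq hτ1 hw hfin hD hζ hξ h.symm (fun m hm => (hmin m hm).symm)
      (Nat.find_spec hex).symm]

/-! ### The tiles are compact and cover the plane -/

/-- The fundamental domain is a continuous image of a closed subset of the compact space
`D ^ ℤ`. -/
theorem isCompact_fundamentalDomain {τ : ℂ} (hτ1 : 1 < ‖τ‖) {w : ℕ} {D : Set ℂ}
    (hfin : D.Finite) : IsCompact (fundamentalDomain τ w D) := by
  refine IsCompact.image_of_continuousOn ?_ ?_
  · refine (isCompact_univ_pi fun _ : ℤ => hfin.isCompact).of_isClosed_subset ?_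
      fun η hη j _ => hη.1.1 j
    have : fractionalWNAFs w D = (⋂ j : ℤ, {η | η j ∈ D}) ∩
        (⋂ (i : ℤ) (j : ℤ) (_ : i < j) (_ : j < i + w), ({η | η i = 0} ∪ {η | η j = 0})) ∩
        ⋂ (j : ℤ) (_ : 0 ≤ j), {η | η j = 0} := by
      ext η
      simp [fractionalWNAFs, isWNAF_iff]
    rw [this]
    have hcl : ∀ j : ℤ, IsClosed {η : ℤ → ℂ | η j = 0} := fun j =>
      isClosed_eq (continuous_apply j) continuous_const
    refine ((isClosed_iInter fun j => ?_).inter (isClosed_iInter fun i => isClosed_iInter fun j =>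
      isClosed_iInter fun _ => isClosed_iInter fun _ => (hcl i).union (hcl j))).inter
      (isClosed_iInter fun j => isClosed_iInter fun _ => hcl j)
    exact hfin.isClosed.preimage (continuous_apply j)
  · obtain ⟨B, -, hB⟩ := exists_norm_le_of_finite hfin
    refine continuousOn_tsum (fun j => ?_) (summable_majorant hτ1 B 0)
      fun j η hη => norm_term_le (fun j => hB _ (hη.1.1 j)) hη.2 j
    exact ((continuous_apply j).mul continuous_const).continuousOn

lemma isCompact_tile {τ : ℂ} (hτ1 : 1 < ‖τ‖) {w : ℕ} {D : Set ℂ}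
    (hfin : D.Finite) (k : ℤ) (ξ : ℤ → ℂ) : IsCompact (tile τ w D k ξ) :=
  (isCompact_fundamentalDomain hτ1 hfin).image (by fun_prop)

/-- Cutting a `w`-NAF within the window `K, …, K + w - 1`, at the nonzero digit there if it
exists and is not the last one, and at `K + w - 1` otherwise, shows that its value lies in a
tile. -/
lemma exists_mem_tile {τ : ℂ} (hτ1 : 1 < ‖τ‖) {w : ℕ} (hw : 1 ≤ w) {D : Set ℂ}
    (hfin : D.Finite) (h0 : (0 : ℂ) ∈ D) (K : ℤ) {a : ℤ → ℂ} (ha : IsWNAF w D a) {l : ℤ}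
    (hl : ∀ j, l ≤ j → a j = 0) :
    ∃ i ∈ tilingIndex w D K, value τ a ∈ tile τ w D i.1 i.2 := by
  have hτ0 : τ ≠ 0 := norm_pos_iff.1 (one_pos.trans hτ1)
  have h2 := (isWNAF_iff.1 ha).2
  have key : ∀ k ∈ Set.Icc K (K + (w : ℤ) - 1), (∀ j, k - w + 1 ≤ j → j < k → a j = 0) →
      (k ≠ K + (w : ℤ) - 1 → a k ≠ 0) →
      ∃ i ∈ tilingIndex w D K, value τ a ∈ tile τ w D i.1 i.2 := by
    intro k hk hgap hak
    refine ⟨(k, fun j => upper k a (j + k)), ⟨hk, ⟨(ha.upper h0 k).shift k, ⟨l - k, fun j hj => ?_⟩,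
      fun j hj => upper_of_lt (by omega)⟩, fun hne => ?_⟩,
      value τ (lower (k - w + 1) a), ⟨_, ha.lower_mem h0 _, rfl⟩, ?_⟩
    · unfold upper
      simp [hl (j + k) (by omega)]
    · simpa [upper_of_le le_rfl] using hak hne
    · have hup : upper (k - w + 1) a = upper k a := by
        funext j
        unfold upper
        split_ifs with h3 h4 h4
        · rfl
        · exact hgap j h3 (not_le.1 h4)
        · omega
        · rfl
      simp only
      rw [ha.value_eq hτ1 hfin h0 hl (k - w + 1), hup, value_shift hτ0, ← mul_assoc,
        ← zpow_add₀ hτ0]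
      simp
  by_cases hex : ∃ k, K ≤ k ∧ k < K + (w : ℤ) - 1 ∧ a k ≠ 0
  · obtain ⟨k, hk1, hk2, hk⟩ := hex
    refine key k ⟨hk1, hk2.le⟩ (fun j hj1 hj2 => ?_) fun _ => hk
    exact (h2 j k hj2 (by omega)).resolve_right hk
  · push Not at hex
    exact key (K + w - 1) ⟨by omega, le_rfl⟩ (fun j hj1 hj2 => hex j (by omega) hj2)
      fun h => absurd rfl h

/-- The tiles form a locally finite family: integer `w`-NAFs with bounded values correspond to
lattice points in a disc. -/
lemma locallyFinite_tile {τ : ℂ} (hτ : IsImaginaryQuadraticInteger τ) (hτ1 : 1 < ‖τ‖)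
    {w : ℕ} (hw : 1 ≤ w) {D : Set ℂ} (hfin : D.Finite) (hD : IsReducedResidueDigitSet τ w D)
    (K : ℤ) : LocallyFinite fun i : tilingIndex w D K => tile τ w D i.1.1 i.1.2 := by
  have hτ0 : τ ≠ 0 := norm_pos_iff.1 (one_pos.trans hτ1)
  obtain ⟨B, hB⟩ := (isCompact_fundamentalDomain hτ1 hfin).isBounded.exists_norm_le (E := ℂ)
    (s := fundamentalDomain τ w D)
  intro z
  refine ⟨Metric.ball z 1, Metric.ball_mem_nhds z one_pos, ?_⟩
  let r : ℤ → ℝ := fun k => ‖τ ^ (-k)‖ * (‖z‖ + 1 + ‖τ ^ (k - w + 1)‖ * B)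
  have hsub : ∀ k, {ξ | ξ ∈ integerWNAFs w D ∧ ‖value τ ξ‖ ≤ r k}.Finite := by
    intro k
    refine Set.Finite.of_finite_image (f := value τ)
      ((finite_lattice_inter_closedBall hτ (r k)).subset ?_)
      ((injOn_value hτ1 hw hfin hD).mono fun ξ hξ => hξ.1)
    rintro _ ⟨ξ, ⟨hξ, hr⟩, rfl⟩
    exact ⟨mapsTo_value_lattice hD.subset_lattice hξ, hr⟩
  refine Set.Finite.of_finite_image (f := Subtype.val) ?_ Subtype.val_injective.injOn
  refine ((Set.finite_Icc K (K + (w : ℤ) - 1)).biUnion fun k _ =>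
    (hsub k).image (Prod.mk k)).subset ?_
  rintro _ ⟨⟨⟨k, ξ⟩, hk, hξ, h3⟩, ⟨x, ⟨y, hy, rfl⟩, hx⟩, rfl⟩
  refine Set.mem_biUnion hk ⟨ξ, ⟨hξ, ?_⟩, rfl⟩
  have hy' := hB y hy
  rw [Metric.mem_ball, dist_eq_norm] at hx
  simp only at hx
  have e : value τ ξ = τ ^ (-k) * ((τ ^ k * value τ ξ + τ ^ (k - w + 1) * y - z) + z -
      τ ^ (k - w + 1) * y) := by
    rw [zpow_neg]
    field_simp
    ring
  rw [e, norm_mul]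
  refine mul_le_mul_of_nonneg_left ?_ (norm_nonneg _)
  refine (norm_sub_le _ _).trans (add_le_add ((norm_add_le _ _).trans (by linarith)) ?_)
  rw [norm_mul]
  gcongr

/-- The union of the tiles is closed, and it contains the dense set `⋃ n, τ ^ (-n) ℤ[τ]`. -/
theorem iUnion_tile_eq_univ {τ : ℂ} (hτ : IsImaginaryQuadraticInteger τ) (hτ1 : 1 < ‖τ‖)
    {w : ℕ} (hw : 2 ≤ w) {R : Set ℂ} (hR : IsRestrictedVoronoiCell τ R)
    {D : Set ℂ} (hD : IsMinNormDigitSet τ w R D) (K : ℤ) :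
    ⋃ i ∈ tilingIndex w D K, tile τ w D i.1 i.2 = Set.univ := by
  have hτ0 : τ ≠ 0 := norm_pos_iff.1 (one_pos.trans hτ1)
  have hfin := hD.finite hτ (by omega)
  rw [Set.biUnion_eq_iUnion]
  have hcl := (locallyFinite_tile hτ hτ1 (by omega) hfin hD.toIsReducedResidueDigitSet
    K).isClosed_iUnion fun i => (isCompact_tile hτ1 hfin i.1.1 i.1.2).isClosed
  refine Set.eq_univ_of_forall fun z => ?_
  rw [← hcl.closure_eq, Metric.mem_closure_iff]
  intro ε hε
  obtain ⟨n, hn⟩ := pow_unbounded_of_one_lt ((1 + ‖τ‖) / ε) hτ1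
  obtain ⟨y, hy, hyz⟩ := exists_mem_lattice_norm_sub_le hτ (τ ^ n * z)
  obtain ⟨ξ, ⟨h1, ⟨l, hl⟩, h2⟩, rfl⟩ := lattice_subset_image_value hτ hτ1 hw hR hD hy
  obtain ⟨i, hi, hit⟩ := exists_mem_tile hτ1 (by omega) hfin hD.zero_mem K (h1.shift n)
    (l := l - n) fun j hj => hl _ (by omega)
  refine ⟨_, Set.mem_iUnion.2 ⟨⟨i, hi⟩, hit⟩, ?_⟩
  rw [value_shift hτ0, dist_eq_norm, zpow_neg, zpow_natCast]
  have e : z - (τ ^ n)⁻¹ * value τ ξ = (τ ^ n)⁻¹ * (τ ^ n * z - value τ ξ) := by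
    field_simp
  rw [e, norm_mul, norm_inv, norm_pow, inv_mul_lt_iff₀ (by positivity)]
  rw [div_lt_iff₀ hε] at hn
  exact hyz.trans_lt hn

/-! ### Overlaps have measure zero -/

open MeasureTheory

lemma volume_image_affine (a c : ℂ) (s : Set ℂ) :
    volume ((fun y => c + a * y) '' s) = ENNReal.ofReal (Complex.normSq a) * volume s := by
  have h1 : (fun y => c + a * y) '' s = (fun y => c + y) '' (LinearMap.mulLeft ℝ a '' s) := by
    rw [Set.image_image]
    rfl
  have h2 : LinearMap.det (LinearMap.mulLeft ℝ a) = Complex.normSq a := by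
    rw [← Algebra.norm_complex_apply, Algebra.norm_apply]
    rfl
  rw [h1, Set.image_add_left, measure_preimage_add, Measure.addHaar_image_linearMap, h2,
    abs_of_nonneg (Complex.normSq_nonneg a)]

/-- A copy of the fundamental domain that contains the values of all fractional `w`-NAFs with
digit `d` at index `-1`: a nonzero digit `d` is followed by `w - 1` zeros. -/
def piece (τ : ℂ) (w : ℕ) (D : Set ℂ) (d : ℂ) : Set ℂ :=
  (fun y => d * τ ^ (-1 : ℤ) + τ ^ (if d = 0 then -1 else -(w : ℤ)) * y) ''
    fundamentalDomain τ w D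

lemma value_mem_piece {τ : ℂ} (hτ1 : 1 < ‖τ‖) {w : ℕ} (hw : 1 ≤ w) {D : Set ℂ}
    (hfin : D.Finite) (h0 : (0 : ℂ) ∈ D) {f : ℤ → ℂ} (hf : f ∈ fractionalWNAFs w D) :
    value τ f ∈ piece τ w D (f (-1)) := by
  set m : ℤ := if f (-1) = 0 then -1 else -(w : ℤ) with hm
  have hm1 : m ≤ -1 := by
    rw [hm]
    split_ifs <;> omega
  refine ⟨_, ⟨_, hf.1.lower_mem h0 m, rfl⟩, ?_⟩
  rw [hf.1.value_eq hτ1 hfin h0 hf.2 m, ← value_single]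
  suffices hup : upper m f = Pi.single (-1) (f (-1)) by rw [hup]
  funext j
  rcases lt_trichotomy j (-1) with hj | rfl | hj
  · rw [Pi.single_eq_of_ne hj.ne]
    rcases lt_or_ge j m with hjm | hjm
    · rw [upper_of_lt hjm]
    · rw [upper_of_le hjm]
      rw [hm] at hjm
      split_ifs at hjm with h
      · omega
      · exact ((isWNAF_iff.1 hf.1).2 j (-1) hj (by omega)).resolve_right h
  · rw [upper_of_le hm1]
    simp
  · rw [upper_of_le (by omega), Pi.single_eq_of_ne hj.ne', hf.2 j (by omega)]

/-- The values of all `w`-NAFs that agree at the indices `≥ j` lie in a copy of a piece. -/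
lemma IsWNAF.value_mem_image_piece {τ : ℂ} (hτ1 : 1 < ‖τ‖) {w : ℕ} (hw : 1 ≤ w) {D : Set ℂ}
    (hfin : D.Finite) (h0 : (0 : ℂ) ∈ D) {a : ℤ → ℂ} (ha : IsWNAF w D a) {l : ℤ}
    (hl : ∀ j, l ≤ j → a j = 0) (j : ℤ) :
    value τ a ∈ (fun y => value τ (WNAF.upper (j + 1) a) + τ ^ (j + 1) * y) ''
      piece τ w D (a j) := by
  refine ⟨value τ (lower (j + 1) a), ?_, (ha.value_eq hτ1 hfin h0 hl _).symm⟩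
  have := value_mem_piece hτ1 hw hfin h0 (ha.lower_mem h0 (j + 1))
  simpa [lower] using this

lemma measurableSet_piece {τ : ℂ} (hτ1 : 1 < ‖τ‖) {w : ℕ} {D : Set ℂ} (hfin : D.Finite)
    (d : ℂ) : MeasurableSet (piece τ w D d) :=
  ((isCompact_fundamentalDomain hτ1 hfin).image (by fun_prop)).measurableSet

/-- If finitely many measurable sets cover a set of at least their total measure, then they are
pairwise disjoint up to null sets. -/
lemma measure_inter_eq_zero_of_sum_le {α ι : Type*} [MeasurableSpace α] {μ : Measure α}
    {s : Finset ι} {A : ι → Set α} (hA : ∀ i ∈ s, MeasurableSet (A i)) {B : Set α}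
    (hB : μ B ≠ ⊤) (hcover : B ⊆ ⋃ i ∈ s, A i) (hsum : ∑ i ∈ s, μ (A i) ≤ μ B)
    {i j : ι} (hi : i ∈ s) (hj : j ∈ s) (hij : i ≠ j) : μ (A i ∩ A j) = 0 := by
  classical
  have hj' : j ∈ s.erase i := Finset.mem_erase.2 ⟨hij.symm, hj⟩
  have h1 : B ⊆ (A i ∪ A j) ∪ ⋃ k ∈ (s.erase i).erase j, A k := by
    intro x hx
    obtain ⟨k, hk, hxk⟩ := Set.mem_iUnion₂.1 (hcover hx)
    by_cases hki : k = i
    · exact Or.inl (Or.inl (hki ▸ hxk))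
    · by_cases hkj : k = j
      · exact Or.inl (Or.inr (hkj ▸ hxk))
      · exact Or.inr (Set.mem_biUnion (by simp [hki, hkj, hk]) hxk)
  have h2 : μ B + μ (A i ∩ A j) ≤ μ B + 0 := by
    calc μ B + μ (A i ∩ A j)
        ≤ μ (A i ∪ A j) + ∑ k ∈ (s.erase i).erase j, μ (A k) + μ (A i ∩ A j) := by
          gcongr
          exact (measure_mono h1).trans ((measure_union_le _ _).trans
            (add_le_add le_rfl (measure_biUnion_finset_le _ _)))
      _ = ∑ k ∈ s, μ (A k) := by
          rw [add_right_comm, measure_union_add_inter _ (hA j hj), ← Finset.add_sum_erase s _ hi,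
            ← Finset.add_sum_erase _ _ hj', add_assoc]
      _ ≤ μ B + 0 := by simpa using hsum
  simpa using (ENNReal.add_le_add_iff_left hB).1 h2

/-- The pieces cover the fundamental domain, and their measures sum up to at most its measure,
as `1 / q + (q - 1) q ^ (w - 1) / q ^ w = 1`. -/
lemma volume_piece_inter_piece {τ : ℂ} (hτ : IsImaginaryQuadraticInteger τ) (hτ1 : 1 < ‖τ‖)
    {w : ℕ} (hw : 1 ≤ w) {D : Set ℂ} (hD : IsReducedResidueDigitSet τ w D) {d e : ℂ}
    (hd : d ∈ D) (he : e ∈ D) (hde : d ≠ e) :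
    volume (piece τ w D d ∩ piece τ w D e) = 0 := by
  classical
  have hfin := hD.finite hτ hw
  obtain ⟨p, q, h, hpq⟩ := hτ
  obtain ⟨-, hq, -⟩ := re_im_of_root h hpq
  have hq0 : 0 < q := by nlinarith
  have hcpt := isCompact_fundamentalDomain (w := w) hτ1 hfin
  have hvol : ∀ d, volume (piece τ w D d) =
      ENNReal.ofReal ((q : ℝ) ^ (if d = 0 then -1 else -(w : ℤ))) *
        volume (fundamentalDomain τ w D) := by
    intro d
    rw [piece, volume_image_affine, map_zpow₀, hq]
  obtain ⟨E, hE, hcard⟩ : ∃ E : Finset ℂ, (∀ d, d ∈ E ↔ d ∈ D ∧ d ≠ 0) ∧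
      E.card ≤ (q.toNat - 1) * q.toNat ^ (w - 1) := by
    obtain ⟨v, rfl⟩ := Nat.exists_eq_add_of_le' hw
    exact exists_finset_nonzero_digits h hq0 hD
  have hE0 : (0 : ℂ) ∉ E := fun h' => ((hE 0).1 h').2 rfl
  have hmem : ∀ x ∈ D, x ∈ insert 0 E := fun x hx => by
    by_cases hx0 : x = 0 <;> simp [hx0, hE, hx]
  refine measure_inter_eq_zero_of_sum_le (s := insert 0 E)
    (fun i _ => measurableSet_piece hτ1 hfin i) hcpt.measure_lt_top.ne ?_ ?_ (hmem d hd)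
    (hmem e he) hde
  · rintro _ ⟨f, hf, rfl⟩
    exact Set.mem_biUnion (hmem _ (hf.1.1 (-1))) (value_mem_piece hτ1 hw hfin hD.zero_mem hf)
  · rw [Finset.sum_insert hE0, hvol, if_pos rfl,
      Finset.sum_congr rfl fun x hx => by rw [hvol, if_neg ((hE x).1 hx).2],
      Finset.sum_const, ← smul_mul_assoc, ← add_mul]
    refine (mul_le_mul_left ?_ _).trans (one_mul _).le
    have hqR : (0 : ℝ) < q := by exact_mod_cast hq0
    rw [nsmul_eq_mul, ← ENNReal.ofReal_natCast, ← ENNReal.ofReal_mul (by positivity),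
      ← ENNReal.ofReal_add (by positivity) (by positivity), ENNReal.ofReal_le_one]
    have hcardR : (E.card : ℝ) ≤ (q - 1) * q ^ (w - 1) := by
      lift q to ℕ using hq0.le
      simp only [Int.toNat_natCast] at hcard
      have : (E.card : ℝ) ≤ (((q - 1) * q ^ (w - 1) : ℕ) : ℝ) := by exact_mod_cast hcard
      rw [Nat.cast_mul, Nat.cast_sub (by omega)] at this
      simpa using this
    rw [zpow_neg, zpow_neg, zpow_one, zpow_natCast, ← mul_pow_sub_one (by omega : w ≠ 0)]
    have hqw : (0 : ℝ) < (q : ℝ) ^ (w - 1) := by positivity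
    calc (q : ℝ)⁻¹ + E.card * (q * (q : ℝ) ^ (w - 1))⁻¹
        ≤ (q : ℝ)⁻¹ + (q - 1) * q ^ (w - 1) * (q * (q : ℝ) ^ (w - 1))⁻¹ := by gcongr
      _ = 1 := by field_simp; ring

lemma volume_fundamentalDomain_ne_zero {τ : ℂ} (hτ : IsImaginaryQuadraticInteger τ)
    (hτ1 : 1 < ‖τ‖) {w : ℕ} (hw : 2 ≤ w) {R : Set ℂ} (hR : IsRestrictedVoronoiCell τ R)
    {D : Set ℂ} (hD : IsMinNormDigitSet τ w R D) :
    volume (fundamentalDomain τ w D) ≠ 0 := by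
  intro hzero
  have hfin := hD.finite hτ (by omega)
  have hcount : (tilingIndex w D 0).Countable := by
    have h1 : (integerWNAFs w D).Countable :=
      (mapsTo_value_lattice hD.subset_lattice).countable_of_injOn
        (injOn_value hτ1 (by omega) hfin hD.toIsReducedResidueDigitSet) (countable_lattice hτ)
    exact (Set.countable_univ.prod h1).mono fun i hi => Set.mem_prod.2 ⟨Set.mem_univ _, hi.2.1⟩
  have h2 : volume (⋃ i ∈ tilingIndex w D 0, tile τ w D i.1 i.2) = 0 := by
    refine (measure_biUnion_null_iff hcount).2 fun i _ => ?_
    rw [tile, volume_image_affine, hzero, mul_zero]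
  rw [iUnion_tile_eq_univ hτ hτ1 hw hR hD 0] at h2
  exact (Measure.measure_univ_ne_zero.2 (NeZero.ne _)) h2

/-- Two distinct tiles overlap in a null set: at the highest index where the digits defining them
differ, the tiles branch into two distinct pieces. -/
theorem volume_tile_inter_tile {τ : ℂ} (hτ : IsImaginaryQuadraticInteger τ) (hτ1 : 1 < ‖τ‖)
    {w : ℕ} (hw : 1 ≤ w) {D : Set ℂ} (hD : IsReducedResidueDigitSet τ w D) {K : ℤ}
    {i i' : ℤ × (ℤ → ℂ)} (hi : i ∈ tilingIndex w D K) (hi' : i' ∈ tilingIndex w D K)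
    (hne : i ≠ i') : volume (tile τ w D i.1 i.2 ∩ tile τ w D i'.1 i'.2) = 0 := by
  have hτ0 : τ ≠ 0 := norm_pos_iff.1 (one_pos.trans hτ1)
  have hfin := hD.finite hτ hw
  have h0 := hD.zero_mem
  -- the digits common to the `w`-NAFs of the elements of a tile, at indices `> k - w`
  let A : ℤ × (ℤ → ℂ) → ℤ → ℂ := fun i j => i.2 (j + -i.1)
  have hlow : ∀ i ∈ tilingIndex w D K, ∀ j < i.1, A i j = 0 := fun i hi j hj =>
    hi.2.1.2.2 _ (by omega)
  -- the tiles differ at some index `> max k k' - w`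
  have hdiff : ∀ i ∈ tilingIndex w D K, ∀ i' ∈ tilingIndex w D K, i.1 < i'.1 →
      ∃ j, i.1 - w < j ∧ i'.1 - w < j ∧ A i j ≠ A i' j := by
    intro i hi i' hi' hlt
    obtain ⟨⟨h1, h2⟩, -, h3⟩ := hi
    obtain ⟨h1', h2'⟩ := hi'.1
    refine ⟨i.1, by omega, by omega, ?_⟩
    rw [hlow i' hi' _ hlt]
    simpa [A] using h3 (by omega)
  have hdiff' : ∃ j, i.1 - w < j ∧ i'.1 - w < j ∧ A i j ≠ A i' j := by
    rcases lt_trichotomy i.1 i'.1 with hlt | heq | hgt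
    · exact hdiff i hi i' hi' hlt
    · have : i.2 ≠ i'.2 := fun h => hne (Prod.ext heq h)
      obtain ⟨j, hj⟩ := Function.ne_iff.1 this
      have hj0 : 0 ≤ j := by
        by_contra! hj0
        exact hj (by rw [hi.2.1.2.2 j hj0, hi'.2.1.2.2 j hj0])
      exact ⟨j + i.1, by omega, by omega, by simpa [A, heq] using hj⟩
    · obtain ⟨j, h1, h2, h3⟩ := hdiff i' hi' i hi hgt
      exact ⟨j, h2, h1, h3.symm⟩
  obtain ⟨l, hl⟩ := hi.2.1.2.1
  obtain ⟨l', hl'⟩ := hi'.2.1.2.1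
  obtain ⟨j₀, hj₀, hj₀', hjne⟩ := hdiff'
  -- the highest index at which the tiles differ
  obtain ⟨j, hj, hjmax⟩ := Int.exists_greatest_of_bdd (P := fun j => A i j ≠ A i' j)
    ⟨max (l + i.1) (l' + i'.1), fun j hj => by
      by_contra! hlt
      exact hj ((hl (j + -i.1) (by omega)).trans (hl' (j + -i'.1) (by omega)).symm)⟩ ⟨j₀, hjne⟩
  have hjj := hjmax j₀ hjne
  have key : ∀ i ∈ tilingIndex w D K, i.1 - w < j → tile τ w D i.1 i.2 ⊆
      (fun y => value τ (upper (j + 1) (A i)) + τ ^ (j + 1) * y) '' piece τ w D (A i j) := by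
    rintro i hi hij _ ⟨_, ⟨f, hf, rfl⟩, rfl⟩
    obtain ⟨h1, ⟨l, hl⟩, h2⟩ := hi.2.1
    have hA : IsWNAF w D (A i) := h1.shift _
    have hAl : ∀ j, l + i.1 ≤ j → A i j = 0 := fun j hj => hl _ (by omega)
    have e1 := value_concat hτ1 hfin i.1 hA hAl hf
    have e2 := (hA.concat hw (hlow i hi) hf).value_mem_image_piece hτ1 hw hfin h0
      (l := max (l + i.1) i.1) (fun j hj => by
        simp only [concat]
        rw [hAl j (by omega), hf.2 _ (by omega), add_zero]) j
    have e3 : ∀ m, j ≤ m → concat w i.1 (A i) f m = A i m := fun m hm => by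
      simp only [concat]
      rw [hf.2 _ (by omega), add_zero]
    have e4 : upper (j + 1) (concat w i.1 (A i) f) = upper (j + 1) (A i) := by
      funext m
      unfold upper
      split_ifs with hm
      · exact e3 m (by omega)
      · rfl
    have e5 : value τ (A i) = τ ^ i.1 * value τ i.2 := by
      rw [value_shift hτ0, neg_neg]
    rw [e1, e3 j le_rfl, e4, e5] at e2
    exact e2
  have hupper : upper (j + 1) (A i) = upper (j + 1) (A i') := by
    funext m
    unfold upper
    split_ifs with hm
    · by_contra hne
      have := hjmax m hne
      omega
    · rfl
  refine measure_mono_null (Set.inter_subset_inter (key i hi (by omega)) (key i' hi' (by omega)))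
    ?_
  have hinj : Function.Injective fun y => value τ (upper (j + 1) (A i)) + τ ^ (j + 1) * y :=
    fun x y hxy => mul_left_cancel₀ (zpow_ne_zero _ hτ0) (add_left_cancel hxy)
  rw [← hupper, ← Set.image_inter hinj, volume_image_affine,
    volume_piece_inter_piece hτ hτ1 hw hD (hi.2.1.1.1 _) (hi'.2.1.1.1 _) hj, mul_zero]

/-! ### The boundaries of the tiles -/

/-- Every neighbourhood of a point of the fundamental domain contains a small copy of the
fundamental domain that is part of it: cut the `w`-NAF of the point far out, and continue with
arbitrary `w`-NAFs. -/
lemma volume_fundamentalDomain_inter_ne_zero {τ : ℂ} (hτ1 : 1 < ‖τ‖) {w : ℕ} (hw : 1 ≤ w)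
    {D : Set ℂ} (hfin : D.Finite) (h0 : (0 : ℂ) ∈ D)
    (hF : volume (fundamentalDomain τ w D) ≠ 0) {y : ℂ} (hy : y ∈ fundamentalDomain τ w D)
    {U : Set ℂ} (hU : U ∈ nhds y) : volume (fundamentalDomain τ w D ∩ U) ≠ 0 := by
  have hτ0 : τ ≠ 0 := norm_pos_iff.1 (one_pos.trans hτ1)
  obtain ⟨B, hB0, hB⟩ :=
    (isCompact_fundamentalDomain (w := w) hτ1 hfin).isBounded.exists_pos_norm_le
  obtain ⟨ε, hε, hεU⟩ := Metric.mem_nhds_iff.1 hU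
  obtain ⟨η, hη, rfl⟩ := hy
  obtain ⟨n, hn⟩ := pow_unbounded_of_one_lt (2 * B / ε) hτ1
  have hu := hη.1.upper h0 (-n)
  have hul : ∀ j, 0 ≤ j → upper (-n) η j = 0 := fun j hj => by
    unfold upper
    simp [hη.2 j hj]
  have hsub : (fun x => value τ (upper (-n) η) + τ ^ (-(n : ℤ) - w + 1) * x) ''
      fundamentalDomain τ w D ⊆ fundamentalDomain τ w D ∩ U := by
    rintro _ ⟨_, ⟨f, hf, rfl⟩, rfl⟩
    constructor
    · refine ⟨concat w (-n) (upper (-n) η) f,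
        ⟨hu.concat hw (fun j hj => upper_of_lt hj) hf, fun j hj => ?_⟩,
        value_concat hτ1 hfin _ hu hul hf⟩
      simp only [concat]
      rw [hul j hj, hf.2 _ (by omega), add_zero]
    · refine hεU ?_
      have e1 := hη.1.value_eq hτ1 hfin h0 hη.2 (-n)
      have h1 := hB _ ⟨_, hf, rfl⟩
      have h2 := hB _ ⟨_, hη.1.lower_mem h0 (-n), rfl⟩
      have h3 : ‖τ ^ (-(n : ℤ) - w + 1)‖ ≤ ‖τ ^ (-(n : ℤ))‖ := by
        rw [norm_zpow, norm_zpow]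
        exact zpow_le_zpow_right₀ hτ1.le (by omega)
      have h4 : ‖τ ^ (-(n : ℤ))‖ * (2 * B) < ε := by
        rw [norm_zpow, zpow_neg, zpow_natCast, inv_mul_lt_iff₀ (by positivity)]
        rwa [div_lt_iff₀ hε] at hn
      rw [Metric.mem_ball, dist_eq_norm, e1, add_sub_add_left_eq_sub]
      refine (norm_sub_le _ _).trans_lt (lt_of_le_of_lt ?_ h4)
      rw [norm_mul, norm_mul, two_mul, mul_add]
      gcongr
  intro hzero
  have h5 := measure_mono_null hsub hzero
  rw [volume_image_affine, mul_eq_zero, ENNReal.ofReal_eq_zero] at h5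
  exact h5.elim (Complex.normSq_pos.2 (zpow_ne_zero _ hτ0)).not_ge hF

/-- A tile with a point in the interior of another tile would overlap with it in a set of positive
measure. -/
lemma tile_inter_tile_subset_frontier {τ : ℂ} (hτ : IsImaginaryQuadraticInteger τ)
    (hτ1 : 1 < ‖τ‖) {w : ℕ} (hw : 1 ≤ w) {D : Set ℂ} (hD : IsReducedResidueDigitSet τ w D)
    (hF : volume (fundamentalDomain τ w D) ≠ 0) {K : ℤ} {i i' : ℤ × (ℤ → ℂ)}
    (hi : i ∈ tilingIndex w D K) (hi' : i' ∈ tilingIndex w D K) (hne : i ≠ i') :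
    tile τ w D i.1 i.2 ∩ tile τ w D i'.1 i'.2 ⊆ frontier (tile τ w D i.1 i.2) := by
  rintro z ⟨hz, hz'⟩
  have hτ0 : τ ≠ 0 := norm_pos_iff.1 (one_pos.trans hτ1)
  have hfin := hD.finite hτ hw
  refine ⟨subset_closure hz, fun hint => ?_⟩
  have hzero := volume_tile_inter_tile hτ hτ1 hw hD hi hi' hne
  obtain ⟨y, hy, rfl⟩ := hz'
  let φ : ℂ → ℂ := fun y => τ ^ i'.1 * value τ i'.2 + τ ^ (i'.1 - (w : ℤ) + 1) * y
  have hφ : Continuous φ := by fun_prop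
  refine volume_fundamentalDomain_inter_ne_zero hτ1 hw hfin hD.zero_mem hF hy
    (hφ.continuousAt.preimage_mem_nhds (mem_interior_iff_mem_nhds.1 hint)) ?_
  have hsub : φ '' (fundamentalDomain τ w D ∩ φ ⁻¹' tile τ w D i.1 i.2) ⊆
      tile τ w D i.1 i.2 ∩ tile τ w D i'.1 i'.2 := by
    rintro _ ⟨x, ⟨hx, hx'⟩, rfl⟩
    exact ⟨hx', x, hx, rfl⟩
  have h5 := measure_mono_null hsub hzero
  rw [volume_image_affine, mul_eq_zero, ENNReal.ofReal_eq_zero] at h5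
  exact h5.resolve_left (Complex.normSq_pos.2 (zpow_ne_zero _ hτ0)).not_ge

end WNAF

theorem mainTheorem6 (τ : ℂ) (hτ : WNAF.IsImaginaryQuadraticInteger τ) (hτ1 : 1 < ‖τ‖)
    (w : ℕ) (hw : 2 ≤ w) (R : Set ℂ) (hR : WNAF.IsRestrictedVoronoiCell τ R)
    (D : Set ℂ) (hD : WNAF.IsMinNormDigitSet τ w R D) (K : ℤ) :
    (⋃ i ∈ WNAF.tilingIndex w D K, WNAF.tile τ w D i.1 i.2) = Set.univ ∧
    ∀ i ∈ WNAF.tilingIndex w D K, ∀ i' ∈ WNAF.tilingIndex w D K, i ≠ i' →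
      WNAF.tile τ w D i.1 i.2 ∩ WNAF.tile τ w D i'.1 i'.2 ⊆
        frontier (WNAF.tile τ w D i.1 i.2) ∩ frontier (WNAF.tile τ w D i'.1 i'.2) := by
  have hw1 : 1 ≤ w := by omega
  have hD' := hD.toIsReducedResidueDigitSet
  have hF := WNAF.volume_fundamentalDomain_ne_zero hτ hτ1 hw hR hD
  refine ⟨WNAF.iUnion_tile_eq_univ hτ hτ1 hw hR hD K, fun i hi i' hi' hne =>
    Set.subset_inter (WNAF.tile_inter_tile_subset_frontier hτ hτ1 hw1 hD' hF hi hi' hne) ?_⟩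
  rw [Set.inter_comm]
  exact WNAF.tile_inter_tile_subset_frontier hτ hτ1 hw1 hD' hF hi' hi hne.symm
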